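/- Let $M$ be a closed oriented smooth 3-manifold and let $\mathcal W\to M$ be a rank 3 vector bundle with an orientation and a smooth fibrewise Minkowski metric $\eta$, i.e. a bundle associated to an $SO(2,1)$-bundle $P$. Let $\mathrm{Tr}\colon\Lambda^3\mathcal W\to\mathbb R$ be the pairing with the volume form. Write $\Omega^{k}(M,\Lambda^l\mathcal W)[j]$ for forms of ghost number $j$ (signs follow the sum of form degree, degree in $\Lambda\mathcal W$ and ghost number). A vector field $\xi$ of ghost number $1$ acts by $\iota_\xi=\xi^a\iota_{\partial_a}$, so $\iota_\xi$ is an even operator whose square need not vanish. Consider the graded spaces of fields (all statements are for points with values in an arbitrary $\mathbb Z$-graded commutative real algebra $G$ of parameters): - $\mathcal F_{BF}$, with coordinates $\tau\in\Omega^0(M,\mathcal W)[1]$, $B\in\Omega^1(M,\mathcal W)[0]$, $A^\dagger\in\Omega^2(M,\mathcal W)[-1]$, $c^\dagger\in\Omega^3(M,\mathcal W)[-2]$, $c\in\Omega^0(M,\Lambda^2\mathcal W)[1]$, a connection $A$ on $P$, $B^\dagger\in\Omega^2(M,\Lambda^2\mathcal W)[-1]$, $\tau^\dagger\in\Omega^3(M,\Lambda^2\mathcal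 W)[-2]$; put $\mathbb B=\tau+B+A^\dagger+c^\dagger$. - $\mathcal F_{PP}$ and $\mathcal F_{GR}$, with coordinates a nondegenerate $e\in\Omega^1(M,\mathcal W)[0]$, a vector field $\xi$ of ghost number $1$, $\chi\in\Omega^0(M,\Lambda^2\mathcal W)[1]$, the antifields $e^\dagger\in\Omega^2(M,\Lambda^2\mathcal W)[-1]$, $\omega^\dagger\in\Omega^2(M,\mathcal W)[-1]$, $\chi^\dagger\in\Omega^3(M,\mathcal W)[-2]$, $\xi^\dagger\in\Omega^1(M)\otimes\Omega^3(M,\Lambda^3\mathcal W)$ of ghost number $-2$, and $\omega$, which is a form in $\Omega^1(M,\Lambda^2\mathcal W)[0]$ for $\mathcal F_{PP}$ and a connection on $P$ for $\mathcal F_{GR}$. Let $\phi_{PP}\colon\mathcal F_{PP}\to\mathcal F_{BF}$ (depending on a reference connection $A_0$) be the symplectomorphism $$\begin{aligned}&\tau=-\iota_\xi e+\tfrac12\iota_\xi^2\omega^\dagger-\tfrac16\iota_\xi^3\chi^\dagger,\quad B=e-\iota_\xi\omega^\dagger+\tfrac12\iota_\xi^2\chi^\dagger,\quad A^\dagger=\omega^\dagger-\iota_\xi\chi^\dagger,\quad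 c^\dagger=\chi^\dagger,\\&c=\chi-\iota_\xi\omega+\tfrac12\iota_\xi^2e^\dagger-\tfrac16\iota_\xi^3\tau^\dagger,\quad A=A_0+\omega-\iota_\xi e^\dagger+\tfrac12\iota_\xi^2\tau^\dagger,\quad B^\dagger=e^\dagger-\iota_\xi\tau^\dagger,\end{aligned}$$ where $\tau^\dagger$ is determined by $\xi^\dagger_a=\tau^\dagger e_a+e^\dagger\omega^\dagger_a+\omega\chi^\dagger_a$ (a subscript $a$ on the other fields denotes contraction with $\partial_a$). Let $\phi_{GR}\colon\mathcal F_{GR}\to\mathcal F_{BF}$ be the composition of $\phi_{PP}$ with the symplectomorphism $\mathcal F_{GR}\to\mathcal F_{PP}$ that sends $\omega^\dagger\mapsto\omega^\dagger+\iota_\xi\chi^\dagger$, $\chi\mapsto\chi+\iota_\xi\omega$, $\xi^\dagger_a\mapsto\xi^\dagger_a+\omega\chi^\dagger_a$ and preserves the other fields (with $\omega$ measured from $A_0$); that is, $$\begin{aligned}&\tau=-\iota_\xi e+\tfrac12\iota_\xi^2\omega^\dagger+\tfrac13\iota_\xi^3\chi^\dagger,\quad B=e-\iota_\xi\omega^\dagger-\tfrac12\iota_\xi^2\chi^\dagger,\quad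 A^\dagger=\omega^\dagger,\quad c^\dagger=\chi^\dagger,\\&c=\chi+\tfrac12\iota_\xi^2e^\dagger-\tfrac16\iota_\xi^3\tau^\dagger,\quad A=\omega-\iota_\xi e^\dagger+\tfrac12\iota_\xi^2\tau^\dagger,\quad B^\dagger=e^\dagger-\iota_\xi\tau^\dagger,\end{aligned}$$ with $\xi^\dagger_a=\tau^\dagger e_a+e^\dagger(\omega^\dagger+\iota_\xi\chi^\dagger)_a$. For $\phi=\phi_{PP}$ and for $\phi=\phi_{GR}$, let $\mathbb q_i$ be the component of form degree $i$ of $\phi^*(e^{\iota_\xi}\mathbb B)$. Then $\mathbb q_0=0$ and $\mathbb q_1=e$. Moreover, for every vector field $\xi$ of ghost number $1$ and every $\mathbb B$ (in particular for the pullbacks by $\phi_{PP}$ and $\phi_{GR}$), the function $$L(t)=\int_M\mathrm{Tr}\,\bigl(e^{t\iota_\xi}\mathbb B\bigr)^3,\qquad t\in\mathbb R,$$ is constant. -/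

import Mathlib

open scoped Manifold ContDiff TensorProduct

set_option linter.unusedSectionVars false

noncomputable section

namespace BVGravity

/-! ### Linear algebra in one fibre

Throughout, `gr` is the grading (the *ghost number*) of a `ℤ`-graded commutative real algebra `G`
of parameters. -/

section Fibre

variable (V : Type*) [AddCommGroup V] [Module ℝ V]

/-- The standard grading of the exterior algebra `ΛV`, indexed by `ℤ`. -/
def extGrading : ℤ → Submodule ℝ (ExteriorAlgebra ℝ V)
  | Int.ofNat n => ⋀[ℝ]^n V
  | Int.negSucc _ => ⊥

/-- The splitting of an element of `ΛV` into its homogeneous components. -/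
def extDecompose : ExteriorAlgebra ℝ V →ₗ[ℝ] DirectSum ℤ fun i => extGrading V i :=
  DirectSum.toModule ℝ ℕ (DirectSum ℤ fun i => extGrading V i)
    (fun n => DirectSum.lof ℝ ℤ (fun i => extGrading V i) (Int.ofNat n) ∘ₗ
      Submodule.inclusion (p := ⋀[ℝ]^n V) (p' := extGrading V (Int.ofNat n)) le_rfl) ∘ₗ
  (DirectSum.decomposeLinearEquiv (fun n : ℕ => ⋀[ℝ]^n V)).toLinearMap

theorem extDecompose_coe (n : ℕ) (a : ⋀[ℝ]^n V) :
    extDecompose V a = DirectSum.lof ℝ ℤ (fun i => extGrading V i) (Int.ofNat n) ⟨a, a.2⟩ := by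
  simp only [extDecompose, LinearMap.comp_apply, LinearEquiv.coe_coe,
    DirectSum.decomposeLinearEquiv_apply, DirectSum.decompose_coe]
  rw [← DirectSum.lof_eq_of ℝ, DirectSum.toModule_lof]
  rfl

instance extGradedMonoid : SetLike.GradedMonoid (extGrading V) where
  one_mem := by
    change (1 : ExteriorAlgebra ℝ V) ∈ ⋀[ℝ]^0 V
    exact SetLike.GradedOne.one_mem
  mul_mem := by
    rintro (i | i) (j | j) a b ha hb
    · have h : a * b ∈ ⋀[ℝ]^(i + j) V := SetLike.GradedMul.mul_mem ha hb
      exact h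
    · have hb0 : b = 0 := (Submodule.mem_bot ℝ).1 hb
      rw [hb0, mul_zero]; exact Submodule.zero_mem _
    · have ha0 : a = 0 := (Submodule.mem_bot ℝ).1 ha
      rw [ha0, zero_mul]; exact Submodule.zero_mem _
    · have ha0 : a = 0 := (Submodule.mem_bot ℝ).1 ha
      rw [ha0, zero_mul]; exact Submodule.zero_mem _

instance extGradedAlgebra : GradedAlgebra (extGrading V) where
  toGradedMonoid := extGradedMonoid V
  toDecomposition := DirectSum.Decomposition.ofLinearMap _ (extDecompose V)
    (by
      refine LinearMap.ext fun a => ?_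
      induction a using DirectSum.Decomposition.inductionOn (fun n : ℕ => ⋀[ℝ]^n V) with
      | zero => simp only [map_zero]
      | add a b ha hb => rw [map_add, map_add, ha, hb]
      | homogeneous a =>
        rw [LinearMap.comp_apply, extDecompose_coe, DirectSum.coeLinearMap_lof]; rfl)
    (by
      refine DirectSum.linearMap_ext ℝ fun i => ?_
      ext1 a
      simp only [LinearMap.comp_apply, DirectSum.coeLinearMap_lof, LinearMap.id_apply]
      match i, a with
      | Int.ofNat n, a => exact extDecompose_coe V n a
      | Int.negSucc n, a =>
        have ha : a = 0 := Subtype.ext ((Submodule.mem_bot ℝ).1 a.2)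
        rw [ha]; simp)

variable {V}
variable {G : Type*} [Ring G] [Algebra ℝ G] (gr : ℤ → Submodule ℝ G) [GradedAlgebra gr]

/-- `ΛV ⊗ G` with the Koszul sign rule: `(a ⊗ g)(b ⊗ h) = (-1)^{|g||b|} ab ⊗ gh`. -/
def Super (V : Type*) [AddCommGroup V] [Module ℝ V] : Type _ := extGrading V ᵍ⊗[ℝ] gr

instance : Ring (Super gr V) := inferInstanceAs (Ring (extGrading V ᵍ⊗[ℝ] gr))

instance : Algebra ℝ (Super gr V) := inferInstanceAs (Algebra ℝ (extGrading V ᵍ⊗[ℝ] gr))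

/-- The identification with the tensor product of vector spaces. -/
def ofTensor : ExteriorAlgebra ℝ V ⊗[ℝ] G ≃ₗ[ℝ] Super gr V :=
  GradedTensorProduct.of ℝ (extGrading V) gr

/-- The element `a ⊗ g`. -/
def tm (a : ExteriorAlgebra ℝ V) (g : G) : Super gr V := ofTensor gr (a ⊗ₜ g)

/-- The inclusion `g ↦ 1 ⊗ g`. -/
def inclG : G →ₐ[ℝ] Super gr V := GradedTensorProduct.includeRight (extGrading V) gr

theorem tm_mul_tm (a : ExteriorAlgebra ℝ V) {i j : ℤ} {g : G} (hg : g ∈ gr i)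
    {b : ExteriorAlgebra ℝ V} (hb : b ∈ extGrading V j) (h : G) :
    tm gr a g * tm gr b h = (((-1 : ℤˣ) ^ (i * j) : ℤˣ) : ℤ) • tm gr (a * b) (g * h) :=
  GradedTensorProduct.tmul_coe_mul_coe_tmul (R := ℝ) (extGrading V) gr a
    (⟨g, hg⟩ : gr i) (⟨b, hb⟩ : extGrading V j) h

theorem inclG_apply (g : G) : inclG gr g = tm gr (1 : ExteriorAlgebra ℝ V) g := rfl

/-- Contraction with a real covector of `V`, acting on the factor `ΛV` of `ΛV ⊗ G`. -/
def contr : Module.Dual ℝ V →ₗ[ℝ] (Super gr V →ₗ[ℝ] Super gr V) where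
  toFun d := (ofTensor gr).toLinearMap ∘ₗ
    TensorProduct.map (CliffordAlgebra.contractLeft (Q := (0 : QuadraticForm ℝ V)) d)
      LinearMap.id ∘ₗ (ofTensor gr).symm.toLinearMap
  map_add' d d' := by
    rw [map_add, TensorProduct.map_add_left, LinearMap.add_comp, LinearMap.comp_add]
  map_smul' c d := by
    rw [map_smul, TensorProduct.map_smul_left, LinearMap.smul_comp, LinearMap.comp_smul]; rfl

theorem contr_tm (d : Module.Dual ℝ V) (a : ExteriorAlgebra ℝ V) (g : G) :
    contr gr d (tm gr a g) =
      tm gr (CliffordAlgebra.contractLeft (Q := (0 : QuadraticForm ℝ V)) d a) g := by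
  simp [contr, tm]

theorem contr_contr (d d' : Module.Dual ℝ V) (s : Super gr V) :
    contr gr d (contr gr d' s) = -contr gr d' (contr gr d s) := by
  obtain ⟨s, rfl⟩ := (ofTensor gr).surjective s
  induction s using TensorProduct.induction_on with
  | zero => simp only [map_zero, neg_zero]
  | add a b ha hb => simp only [map_add, neg_add, ha, hb]
  | tmul a g =>
    change contr gr d (contr gr d' (tm gr a g)) = -contr gr d' (contr gr d (tm gr a g))
    simp only [contr_tm]
    rw [CliffordAlgebra.contractLeft_comm, tm, tm, TensorProduct.neg_tmul, map_neg]

theorem contr_skew (d d' : Module.Dual ℝ V) (p q a : Super gr V) :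
    -contr gr d (p + contr gr d' a) - contr gr d' (q + contr gr d a) =
      -contr gr d p - contr gr d' q := by
  rw [map_add, map_add, contr_contr gr d]
  abel

variable {T U : Type*} [AddCommGroup T] [Module ℝ T] [AddCommGroup U] [Module ℝ U]

/-- A tangent vector as a linear form on `T* ⊕ W` (evaluation on `T*`, zero on `W`). -/
def evalT : T →ₗ[ℝ] Module.Dual ℝ (Module.Dual ℝ T × U) where
  toFun v := Module.Dual.eval ℝ T v ∘ₗ LinearMap.fst ℝ _ _
  map_add' v w := by rw [map_add, LinearMap.add_comp]
  map_smul' c v := by rw [map_smul, LinearMap.smul_comp]; rfl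

/-- A linear form on `W` as a linear form on `T* ⊕ W` (zero on `T*`). -/
def evalW (f : Module.Dual ℝ U) : Module.Dual ℝ (Module.Dual ℝ T × U) := f ∘ₗ LinearMap.snd ℝ _ _

/-- The contraction `ι_ξ = ξ^a ι_a` with a `G`-valued tangent vector `ξ = ξ^a ∂_a ∈ T ⊗ G`. -/
def iota : T ⊗[ℝ] G →ₗ[ℝ]
    (Super gr (Module.Dual ℝ T × U) →ₗ[ℝ] Super gr (Module.Dual ℝ T × U)) :=
  TensorProduct.lift
    ((LinearMap.mul ℝ (Module.End ℝ (Super gr (Module.Dual ℝ T × U)))).flip.compl₁₂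
        (contr gr ∘ₗ evalT)
        ((Algebra.lmul ℝ (Super gr (Module.Dual ℝ T × U))).toLinearMap ∘ₗ
          (inclG gr).toLinearMap))

theorem iota_tmul (v : T) (g : G) (s : Super gr (Module.Dual ℝ T × U)) :
    iota gr (v ⊗ₜ g) s = inclG gr g * contr gr (evalT v) s := rfl

/-- The part of `s ∈ Λ(T* ⊕ W) ⊗ G` in `Λ³T* ⊗ Λ³W ⊗ G`, evaluated on three tangent vectors and
traced with the volume form `vol` of `W`. -/
def trTop (vol : U [⋀^Fin 3]→ₗ[ℝ] ℝ) (v : Fin 3 → T) :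
    Super gr (Module.Dual ℝ T × U) →ₗ[ℝ] G :=
  let c (i : Fin 3) := CliffordAlgebra.contractLeft
    (Q := (0 : QuadraticForm ℝ (Module.Dual ℝ T × U))) (evalT (v i))
  let onForms : ExteriorAlgebra ℝ (Module.Dual ℝ T × U) →ₗ[ℝ] ℝ :=
    ExteriorAlgebra.liftAlternating (Pi.single 3 vol) ∘ₗ
      (ExteriorAlgebra.map (LinearMap.snd ℝ (Module.Dual ℝ T) U)).toLinearMap ∘ₗ
        c 2 ∘ₗ c 1 ∘ₗ c 0
  (TensorProduct.lid ℝ G).toLinearMap ∘ₗ TensorProduct.map onForms LinearMap.id ∘ₗ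
    (ofTensor gr).symm.toLinearMap

end Fibre

/-! ### Forms on a three-manifold -/

/-- The model space of a three-manifold. -/
abbrev E3 : Type := EuclideanSpace ℝ (Fin 3)

section Manifold

variable (M : Type*) [TopologicalSpace M] [ChartedSpace E3 M]

/-- The atlas of `M` is oriented: all changes of coordinates have positive Jacobian. -/
def IsOrientedAtlas : Prop :=
  ∀ φ ∈ atlas E3 M, ∀ ψ ∈ atlas E3 M, ∀ y ∈ (φ.symm.trans ψ).source,
    0 < (fderiv ℝ (φ.symm.trans ψ) y).det

variable {M} in
/-- The tangent space of `M` at `x`. -/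
abbrev TM (x : M) : Type := TangentSpace 𝓘(ℝ, E3) x

/-- Smooth functions. -/
abbrev Fn : Type _ := C^∞⟮𝓘(ℝ, E3), M; 𝓘(ℝ, ℝ), ℝ⟯

variable [IsManifold 𝓘(ℝ, E3) ∞ M]

/-- Smooth vector fields. -/
abbrev VF : Type _ := Cₛ^∞⟮𝓘(ℝ, E3); E3, (TM : M → Type)⟯

/-- Smooth one-forms: smooth on every smooth vector field. -/
structure OneForm where
  val : ∀ x : M, Module.Dual ℝ (TM x)
  smooth : ∀ X : VF M, ContMDiff 𝓘(ℝ, E3) 𝓘(ℝ, ℝ) ∞ fun x => val x (X x)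

/-- The coordinate frame `(∂₁, ∂₂, ∂₃)` of the chart at `p`, at the point with coordinates `y`. -/
def coordFrame (p : M) (y : E3) (j : Fin 3) : TM ((chartAt E3 p).symm y) :=
  mfderiv 𝓘(ℝ, E3) 𝓘(ℝ, E3) (chartAt E3 p).symm y (EuclideanSpace.single j (1 : ℝ))

/-- A smooth partition of unity subordinate to the charts of the atlas. -/
def chartPartition [T2Space M] [CompactSpace M] :
    SmoothPartitionOfUnity M 𝓘(ℝ, E3) M Set.univ :=
  (SmoothPartitionOfUnity.exists_isSubordinate_chartAt_source 𝓘(ℝ, E3) M).choose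

variable {M} in
/-- The integral over `M`, with its oriented atlas, of a three-form `σ`, given by the functions
`v ↦ σ_x(v₁, v₂, v₃)`. -/
def integral [T2Space M] [CompactSpace M] (σ : ∀ x : M, (Fin 3 → TM x) → ℝ) : ℝ :=
  ∑ᶠ p : M, ∫ y in (chartAt E3 p).target,
    chartPartition M p ((chartAt E3 p).symm y) *
      σ ((chartAt E3 p).symm y) (coordFrame M p y)

section Bundle

variable {M}
variable (W : M → Type*) [TopologicalSpace (Bundle.TotalSpace E3 W)]
  [∀ x, AddCommGroup (W x)] [∀ x, Module ℝ (W x)] [∀ x, TopologicalSpace (W x)]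
  [FiberBundle E3 W] [VectorBundle ℝ E3 W] [ContMDiffVectorBundle ∞ E3 W 𝓘(ℝ, E3)]

/-- Smooth sections of `W`. -/
abbrev Sec : Type _ := Cₛ^∞⟮𝓘(ℝ, E3); E3, W⟯

/-- An oriented Minkowski structure on the rank three bundle `W`, i.e. a reduction of its frame
bundle to an `SO(2,1)`-bundle `P`: a smooth fibrewise metric `η` of signature `(2,1)` and a smooth
volume form `vol`, equal to one on suitable orthonormal bases. -/
structure Minkowski where
  η : ∀ x, W x →ₗ[ℝ] W x →ₗ[ℝ] ℝ
  vol : ∀ x, W x [⋀^Fin 3]→ₗ[ℝ] ℝ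
  smooth_η : ∀ s s' : Sec W, ContMDiff 𝓘(ℝ, E3) 𝓘(ℝ, ℝ) ∞ fun x => η x (s x) (s' x)
  smooth_vol : ∀ s : Fin 3 → Sec W,
    ContMDiff 𝓘(ℝ, E3) 𝓘(ℝ, ℝ) ∞ fun x => vol x fun i => s i x
  orthonormal : ∀ x, ∃ b : Module.Basis (Fin 3) ℝ (W x),
    (∀ i j, η x (b i) (b j) = Matrix.diagonal ![(1 : ℝ), 1, -1] i j) ∧ vol x b = 1

/-- The fibre of `T*M ⊕ W` at `x`. -/
abbrev Fib (x : M) : Type _ := Module.Dual ℝ (TM x) × W x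

/-- `Ω^k(M, Λ^l W)`, the smooth sections of `Λ^k T*M ⊗ Λ^l W ⊆ Λ(T*M ⊕ W)`: finite sums of
products of a function, `k` one-forms and `l` sections of `W` (`M` being compact, all smooth
sections are of this form). -/
def Form (k l : ℕ) : Submodule ℝ (∀ x : M, ExteriorAlgebra ℝ (Fib W x)) :=
  Submodule.span ℝ {a | ∃ (f : Fn M) (α : Fin k → OneForm M) (w : Fin l → Sec W), ∀ x,
    a x = f x • (ExteriorAlgebra.ιMulti ℝ k (fun i => ((α i).val x, (0 : W x))) *
      ExteriorAlgebra.ιMulti ℝ l (fun i => ((0 : Module.Dual ℝ (TM x)), w i x)))}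

variable {G : Type*} [Ring G] [Algebra ℝ G] (gr : ℤ → Submodule ℝ G) [GradedAlgebra gr]

/-- Sections of the bundle of algebras `Λ(T*M ⊕ W) ⊗ G`, with pointwise operations. -/
abbrev SF : Type _ := ∀ x : M, Super gr (Fib W x)

/-- `Ω^k(M, Λ^l W)[j]`: the fields of form degree `k`, with values in `Λ^l W`, of ghost number
`j`. -/
def Om (k l : ℕ) (j : ℤ) : Submodule ℝ (SF W gr) :=
  Submodule.span ℝ {s | ∃ a ∈ Form W k l, ∃ g ∈ gr j, ∀ x, s x = tm gr (a x) g}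

variable (M) in
/-- `𝔛(M)[j]`: the vector fields of ghost number `j`. -/
def Vect (j : ℤ) : Submodule ℝ (∀ x : M, TM x ⊗[ℝ] G) :=
  Submodule.span ℝ {ξ | ∃ X : VF M, ∃ g ∈ gr j, ∀ x, ξ x = X x ⊗ₜ[ℝ] g}

variable {W} in
/-- The operator `ι_ξ` on superfields. -/
def iotaS (ξ : ∀ x : M, TM x ⊗[ℝ] G) : SF W gr →ₗ[ℝ] SF W gr :=
  LinearMap.pi fun x => iota gr (ξ x) ∘ₗ LinearMap.proj x

/-! Contractions of smooth forms are smooth. -/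

section Closure

/-- Contraction on `Λ(T*M ⊕ W)`. -/
abbrev ctr {x : M} (d : Module.Dual ℝ (Fib W x)) (a : ExteriorAlgebra ℝ (Fib W x)) :
    ExteriorAlgebra ℝ (Fib W x) :=
  CliffordAlgebra.contractLeft (Q := (0 : QuadraticForm ℝ (Fib W x))) d a

variable {W}

theorem ctr_ι_mul {x : M} (d : Module.Dual ℝ (Fib W x)) (m : Fib W x)
    (b : ExteriorAlgebra ℝ (Fib W x)) :
    ctr W d (ExteriorAlgebra.ι ℝ m * b) = d m • b - ExteriorAlgebra.ι ℝ m * ctr W d b :=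
  CliffordAlgebra.contractLeft_ι_mul (Q := (0 : QuadraticForm ℝ (Fib W x))) d m b

theorem ctr_one {x : M} (d : Module.Dual ℝ (Fib W x)) : ctr W d 1 = 0 :=
  CliffordAlgebra.contractLeft_one (Q := (0 : QuadraticForm ℝ (Fib W x))) d

theorem Form.smul_mem {k l : ℕ} (f : Fn M) {a : ∀ x : M, ExteriorAlgebra ℝ (Fib W x)}
    (ha : a ∈ Form W k l) : (fun x => f x • a x) ∈ Form W k l := by
  induction ha using Submodule.span_induction with
  | mem a ha =>
    obtain ⟨h, α, w, ha⟩ := ha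
    refine Submodule.subset_span ⟨f * h, α, w, fun x => ?_⟩
    simp only [ha x, smul_smul, ContMDiffMap.coe_mul, Pi.mul_apply]
  | zero =>
    convert! Submodule.zero_mem (Form W k l) using 1
    funext x
    simp
  | add a b _ _ ha hb => simpa [smul_add] using! Submodule.add_mem _ ha hb
  | smul c a _ ha =>
    convert! Submodule.smul_mem _ c ha using 1
    funext x
    exact smul_comm (f x) c (a x)

theorem Form.ι_mul_mem {k l : ℕ} (α : OneForm M) {a : ∀ x : M, ExteriorAlgebra ℝ (Fib W x)}
    (ha : a ∈ Form W k l) :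
    (fun x => ExteriorAlgebra.ι ℝ ((α.val x, 0) : Fib W x) * a x) ∈ Form W (k + 1) l := by
  induction ha using Submodule.span_induction with
  | mem a ha =>
    obtain ⟨h, β, w, ha⟩ := ha
    refine Submodule.subset_span ⟨h, Matrix.vecCons α β, w, fun x => ?_⟩
    dsimp only
    rw [ha x, ExteriorAlgebra.ιMulti_succ_apply, mul_smul_comm, mul_assoc]
    rfl
  | zero =>
    convert! Submodule.zero_mem (Form W (k + 1) l) using 1
    funext x
    simp
  | add a b _ _ ha hb => simpa [mul_add] using! Submodule.add_mem _ ha hb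
  | smul c a _ ha => simpa using! Submodule.smul_mem _ c ha

theorem Form.ιW_mul_mem {l : ℕ} (s : Sec W) {a : ∀ x : M, ExteriorAlgebra ℝ (Fib W x)}
    (ha : a ∈ Form W 0 l) :
    (fun x => ExteriorAlgebra.ι ℝ ((0, s x) : Fib W x) * a x) ∈ Form W 0 (l + 1) := by
  induction ha using Submodule.span_induction with
  | mem a ha =>
    obtain ⟨h, β, w, ha⟩ := ha
    refine Submodule.subset_span ⟨h, β, Matrix.vecCons s w, fun x => ?_⟩
    dsimp only
    rw [ha x, ExteriorAlgebra.ιMulti_succ_apply, mul_smul_comm, ExteriorAlgebra.ιMulti_zero_apply,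
      one_mul, one_mul]
    rfl
  | zero =>
    convert! Submodule.zero_mem (Form W 0 (l + 1)) using 1
    funext x
    simp
  | add a b _ _ ha hb => simpa [mul_add] using! Submodule.add_mem _ ha hb
  | smul c a _ ha => simpa using! Submodule.smul_mem _ c ha

/-- A product of one-forms and sections of `W`. -/
abbrev prodForm {k l : ℕ} (α : Fin k → OneForm M) (w : Fin l → Sec W) (x : M) :
    ExteriorAlgebra ℝ (Fib W x) :=
  ExteriorAlgebra.ιMulti ℝ k (fun i => ((α i).val x, (0 : W x))) *
      ExteriorAlgebra.ιMulti ℝ l (fun i => ((0 : Module.Dual ℝ (TM x)), w i x))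

theorem prodForm_mem {k l : ℕ} (α : Fin k → OneForm M) (w : Fin l → Sec W) :
    prodForm α w ∈ Form W k l :=
  Submodule.subset_span ⟨1, α, w, fun x => by simp⟩

theorem prodForm_succ {k l : ℕ} (α : Fin (k + 1) → OneForm M) (w : Fin l → Sec W) (x : M) :
    prodForm α w x =
      ExteriorAlgebra.ι ℝ (((α 0).val x, 0) : Fib W x) * prodForm (Matrix.vecTail α) w x := by
  rw [prodForm, ExteriorAlgebra.ιMulti_succ_apply, mul_assoc]
  rfl

theorem prodForm_zero_succ {l : ℕ} (α : Fin 0 → OneForm M) (w : Fin (l + 1) → Sec W) (x : M) :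
    prodForm α w x =
      ExteriorAlgebra.ι ℝ ((0, w 0 x) : Fib W x) * prodForm α (Matrix.vecTail w) x := by
  rw [prodForm, ExteriorAlgebra.ιMulti_succ_apply, ExteriorAlgebra.ιMulti_zero_apply, one_mul,
    prodForm, ExteriorAlgebra.ιMulti_zero_apply, one_mul]
  rfl

theorem prodForm_zero_zero (α : Fin 0 → OneForm M) (w : Fin 0 → Sec W) (x : M) :
    prodForm α w x = 1 := by
  rw [prodForm, ExteriorAlgebra.ιMulti_zero_apply, ExteriorAlgebra.ιMulti_zero_apply, one_mul]

theorem ctr_prodForm_zero {l : ℕ} (v : ∀ x : M, TM x) (α : Fin 0 → OneForm M)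
    (w : Fin l → Sec W) (x : M) : ctr W (evalT (v x)) (prodForm α w x) = 0 := by
  induction l with
  | zero => rw [prodForm_zero_zero, ctr_one]
  | succ l ih =>
    rw [prodForm_zero_succ, ctr_ι_mul, ih]
    simp [evalT]

theorem ctr_prodForm_mem {k l : ℕ} (X : VF M) (α : Fin (k + 1) → OneForm M) (w : Fin l → Sec W) :
    (fun x => ctr W (evalT (X x)) (prodForm α w x)) ∈ Form W k l := by
  induction k with
  | zero =>
    have h := Form.smul_mem ⟨_, (α 0).smooth X⟩ (prodForm_mem (Matrix.vecTail α) w)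
    convert! h using 1
    ext x
    rw [prodForm_succ, ctr_ι_mul, ctr_prodForm_zero, mul_zero, sub_zero]
    rfl
  | succ k ih =>
    have h := Form.smul_mem ⟨_, (α 0).smooth X⟩ (prodForm_mem (Matrix.vecTail α) w)
    have h' := Form.ι_mul_mem (α 0) (ih (Matrix.vecTail α))
    convert! Submodule.sub_mem _ h h' using 1
    ext x
    rw [prodForm_succ, ctr_ι_mul]
    rfl

theorem Form.ctr_mem {k l : ℕ} (X : VF M) {a : ∀ x : M, ExteriorAlgebra ℝ (Fib W x)}
    (ha : a ∈ Form W (k + 1) l) : (fun x => ctr W (evalT (X x)) (a x)) ∈ Form W k l := by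
  induction ha using Submodule.span_induction with
  | mem a ha =>
    obtain ⟨f, α, w, ha⟩ := ha
    simp only [ha, map_smul]
    exact Form.smul_mem f (ctr_prodForm_mem X α w)
  | zero =>
    convert! Submodule.zero_mem (Form W k l) using 1
    funext x
    simp
  | add a b _ _ ha hb => simpa using! Submodule.add_mem _ ha hb
  | smul c a _ ha => simpa using! Submodule.smul_mem _ c ha

variable {d : ∀ x : M, Module.Dual ℝ (W x)}

theorem ctrW_prodForm_zero_mem (hd : ∀ s : Sec W, ContMDiff 𝓘(ℝ, E3) 𝓘(ℝ, ℝ) ∞ fun x => d x (s x))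
    {l : ℕ} (α : Fin 0 → OneForm M) (w : Fin (l + 1) → Sec W) :
    (fun x => ctr W (evalW (d x)) (prodForm α w x)) ∈ Form W 0 l := by
  induction l with
  | zero =>
    have h := Form.smul_mem ⟨_, hd (w 0)⟩ (prodForm_mem α (Matrix.vecTail w))
    convert! h using 1
    ext x
    rw [prodForm_zero_succ, ctr_ι_mul, prodForm_zero_zero, ctr_one, mul_zero, sub_zero]
    rfl
  | succ k ih =>
    have h := Form.smul_mem ⟨_, hd (w 0)⟩ (prodForm_mem α (Matrix.vecTail w))
    have h' := Form.ιW_mul_mem (w 0) (ih (Matrix.vecTail w))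
    convert! Submodule.sub_mem _ h h' using 1
    ext x
    rw [prodForm_zero_succ, ctr_ι_mul]
    rfl

theorem ctrW_prodForm_mem (hd : ∀ s : Sec W, ContMDiff 𝓘(ℝ, E3) 𝓘(ℝ, ℝ) ∞ fun x => d x (s x))
    {k l : ℕ} (α : Fin k → OneForm M) (w : Fin (l + 1) → Sec W) :
    (fun x => ctr W (evalW (d x)) (prodForm α w x)) ∈ Form W k l := by
  induction k with
  | zero => exact ctrW_prodForm_zero_mem hd α w
  | succ k ih =>
    have h' := Form.ι_mul_mem (α 0) (ih (Matrix.vecTail α))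
    convert! Submodule.neg_mem _ h' using 1
    ext x
    rw [prodForm_succ, ctr_ι_mul]
    simp [evalW]

theorem Form.ctrW_mem (hd : ∀ s : Sec W, ContMDiff 𝓘(ℝ, E3) 𝓘(ℝ, ℝ) ∞ fun x => d x (s x))
    {k l : ℕ} {a : ∀ x : M, ExteriorAlgebra ℝ (Fib W x)} (ha : a ∈ Form W k (l + 1)) :
    (fun x => ctr W (evalW (d x)) (a x)) ∈ Form W k l := by
  induction ha using Submodule.span_induction with
  | mem a ha =>
    obtain ⟨f, α, w, ha⟩ := ha
    simp only [ha, map_smul]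
    exact Form.smul_mem f (ctrW_prodForm_mem hd α w)
  | zero =>
    convert! Submodule.zero_mem (Form W k l) using 1
    funext x
    simp
  | add a b _ _ ha hb => simpa using! Submodule.add_mem _ ha hb
  | smul c a _ ha => simpa using! Submodule.smul_mem _ c ha

theorem Form.degree {k l : ℕ} {a : ∀ x : M, ExteriorAlgebra ℝ (Fib W x)} (ha : a ∈ Form W k l)
    (x : M) : a x ∈ extGrading (Fib W x) (Int.ofNat (k + l)) := by
  change a x ∈ ⋀[ℝ]^(k + l) (Fib W x)
  induction ha using Submodule.span_induction with
  | mem a ha =>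
    obtain ⟨f, α, w, ha⟩ := ha
    rw [ha x]
    exact Submodule.smul_mem _ _ (SetLike.GradedMul.mul_mem (A := fun n : ℕ => ⋀[ℝ]^n (Fib W x))
      (ExteriorAlgebra.ιMulti_range ℝ k ⟨_, rfl⟩) (ExteriorAlgebra.ιMulti_range ℝ l ⟨_, rfl⟩))
  | zero => exact Submodule.zero_mem _
  | add a b _ _ ha hb => exact Submodule.add_mem _ ha hb
  | smul c a _ ha => exact Submodule.smul_mem _ c ha

theorem iotaS_mem {k l : ℕ} {i j n : ℤ} (hn : i + j = n) {ξ : ∀ x : M, TM x ⊗[ℝ] G}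
    (hξ : ξ ∈ Vect M gr i) {s : SF W gr} (hs : s ∈ Om W gr (k + 1) l j) :
    iotaS gr ξ s ∈ Om W gr k l n := by
  subst hn
  induction hξ using Submodule.span_induction with
  | mem ξ hξ =>
    obtain ⟨X, θ, hθ, hξ⟩ := hξ
    induction hs using Submodule.span_induction with
    | mem s hs =>
      obtain ⟨a, ha, g, hg, hs⟩ := hs
      have hc := Form.ctr_mem X ha
      have h : (fun x => tm gr (ctr W (evalT (X x)) (a x)) (θ * g)) ∈ Om W gr k l (i + j) :=
        Submodule.subset_span ⟨_, hc, _, SetLike.GradedMul.mul_mem hθ hg, fun x => rfl⟩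
      have h2 : iotaS gr ξ s = (((-1 : ℤˣ) ^ (i * Int.ofNat (k + l)) : ℤˣ) : ℤ) •
          (fun x => tm gr (ctr W (evalT (X x)) (a x)) (θ * g) : SF W gr) := by
        funext x
        change iota gr (ξ x) (s x) = _
        rw [hξ x, hs x, iota_tmul, contr_tm, inclG_apply, tm_mul_tm gr _ hθ (Form.degree hc x),
          one_mul]
        rfl
      rw [h2]
      exact zsmul_mem h _
    | zero => rw [map_zero]; exact Submodule.zero_mem _
    | add a b _ _ ha hb => rw [map_add]; exact Submodule.add_mem _ ha hb
    | smul c a _ ha => rw [map_smul]; exact Submodule.smul_mem _ c ha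
  | zero =>
    have h : iotaS gr (0 : ∀ x : M, TM x ⊗[ℝ] G) s = 0 := by
      funext x
      simp [iotaS]
    rw [h]
    exact Submodule.zero_mem _
  | add a b _ _ ha hb =>
    convert! Submodule.add_mem _ ha hb using 1
    funext x
    simp [iotaS]
  | smul c a _ ha =>
    convert! Submodule.smul_mem _ c ha using 1
    funext x
    simp [iotaS]

theorem contrW_mem (hd : ∀ s : Sec W, ContMDiff 𝓘(ℝ, E3) 𝓘(ℝ, ℝ) ∞ fun x => d x (s x))
    {k l : ℕ} {j : ℤ} {s : SF W gr} (hs : s ∈ Om W gr k (l + 1) j) :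
    (fun x => contr gr (evalW (d x)) (s x)) ∈ Om W gr k l j := by
  induction hs using Submodule.span_induction with
  | mem s hs =>
    obtain ⟨a, ha, g, hg, hs⟩ := hs
    refine Submodule.subset_span ⟨_, Form.ctrW_mem hd ha, g, hg, fun x => ?_⟩
    dsimp only
    rw [hs x, contr_tm]
  | zero =>
    convert! Submodule.zero_mem (Om W gr k l j) using 1
  | add a b _ _ ha hb => simpa using! Submodule.add_mem _ ha hb
  | smul c a _ ha => simpa using! Submodule.smul_mem _ c ha

end Closure

/-! ### Fields -/

/-- The differential of a function at `x`. -/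
def dFn (f : M → ℝ) (x : M) : Module.Dual ℝ (TM x) :=
  (show TM x →L[ℝ] ℝ from mfderiv 𝓘(ℝ, E3) 𝓘(ℝ, ℝ) f x).toLinearMap

variable {W} (m : Minkowski W)

theorem Minkowski.smooth_flat (s : Sec W) :
    ∀ s' : Sec W, ContMDiff 𝓘(ℝ, E3) 𝓘(ℝ, ℝ) ∞ fun x => m.η x (s x) (s' x) :=
  m.smooth_η s

/-- The connections on `P`, with parameters in `G`: the metric covariant derivatives `s ↦ ∇s` on
`W`, with `∇s ∈ Ω¹(M, W)[0]`. Contracting `∇s` with the linear form `η(s', ·)` of `W` yields the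
one-form `-η(∇s, s')`. -/
structure Conn where
  cov : Sec W → SF W gr
  mem : ∀ s, cov s ∈ Om W gr 1 1 0
  add : ∀ s s', cov (s + s') = cov s + cov s'
  leibniz : ∀ (f : Fn M) (s s' : Sec W), (∀ x, s' x = f x • s x) → ∀ x, cov s' x =
    f x • cov s x + tm gr (ExteriorAlgebra.ι ℝ ((dFn f x, 0) : Fib W x) *
      ExteriorAlgebra.ι ℝ ((0, s x) : Fib W x)) 1
  metric : ∀ (s s' : Sec W) (x : M),
    -contr gr (evalW (m.η x (s' x))) (cov s x) - contr gr (evalW (m.η x (s x))) (cov s' x) =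
      tm gr (ExteriorAlgebra.ι ℝ ((dFn (fun x => m.η x (s x) (s' x)) x, 0) : Fib W x)) 1

theorem evalW_smul {x : M} (r : ℝ) (f : Module.Dual ℝ (W x)) :
    evalW (T := TM x) (r • f) = r • evalW f := rfl

variable {gr m}

/-- The affine action of `Ω¹(M, Λ²W)[0]` on connections: `Λ²W` is identified with the Lie algebra
of skew endomorphisms of `W`, `u ∧ v` being `s ↦ η(v, s) u - η(u, s) v`. -/
def Conn.addForm (A : Conn gr m) (a : Om W gr 1 2 0) : Conn gr m where
  cov s := fun x => A.cov s x + contr gr (evalW (m.η x (s x))) (a.1 x)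
  mem s := Submodule.add_mem _ (A.mem s) (contrW_mem gr (m.smooth_flat s) a.2)
  add s s' := by
    funext x
    have h : evalW (T := TM x) (m.η x ((s + s') x)) =
        evalW (m.η x (s x)) + evalW (m.η x (s' x)) := by
      rw [ContMDiffSection.coe_add, Pi.add_apply, map_add]; rfl
    simp only [A.add, Pi.add_apply, h, map_add, LinearMap.add_apply]
    abel
  leibniz f s s' h x := by
    have h' : contr gr (evalW (m.η x (s' x))) (a.1 x) =
        f x • contr gr (evalW (m.η x (s x))) (a.1 x) := by
      rw [h x, map_smul, evalW_smul, map_smul, LinearMap.smul_apply]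
    change A.cov s' x + contr gr (evalW (m.η x (s' x))) (a.1 x) =
      f x • (A.cov s x + contr gr (evalW (m.η x (s x))) (a.1 x)) + _
    rw [A.leibniz f s s' h x, h', smul_add]
    exact add_right_comm _ _ _
  metric s s' x :=
    (contr_skew gr (evalW (m.η x (s' x))) (evalW (m.η x (s x))) (A.cov s x) (A.cov s' x)
      (a.1 x)).trans (A.metric s s' x)

variable (W gr)

/-- The fields and antifields of gravity other than the connection `ω`. An antifield is a section
of the bundle dual to that of the field (twisted by three-forms), under the trace pairings. The
co-frame `e` is an isomorphism from `TM` to `W`. -/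
structure GravityFields where
  e : Om W gr 1 1 0
  e_nondegenerate : ∀ w ∈ Om W gr 0 1 0,
    ∃! X : ∀ x : M, TM x ⊗[ℝ] G, X ∈ Vect M gr 0 ∧ iotaS gr X e.1 = w
  ξ : Vect M gr 1
  χ : Om W gr 0 2 1
  eDag : Om W gr 2 2 (-1)
  omegaDag : Om W gr 2 1 (-1)
  χDag : Om W gr 3 1 (-2)
  ξDag : ∀ x : M, TM x →ₗ[ℝ] Super gr (Fib W x)
  ξDag_mem : ∀ X : VF M, (fun x => ξDag x (X x)) ∈ Om W gr 3 3 (-2)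

/-- `𝓕_PP`, where the connection is represented by `ω ∈ Ω¹(M, Λ²W)`. -/
structure FieldsPP extends GravityFields W gr where
  omega : Om W gr 1 2 0

variable {W} (m)

/-- `𝓕_GR`. -/
structure FieldsGR extends GravityFields W gr where
  omega : Conn gr m

/-- `𝓕_BF`, with the superfields `𝔹 = τ + B + A† + c†` and `𝔸 = c + A + B† + τ†`. -/
structure FieldsBF where
  τ : Om W gr 0 1 1
  B : Om W gr 1 1 0
  ADag : Om W gr 2 1 (-1)
  cDag : Om W gr 3 1 (-2)
  c : Om W gr 0 2 1
  A : Conn gr m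
  BDag : Om W gr 2 2 (-1)
  τDag : Om W gr 3 2 (-2)

variable {gr m}

/-- The operator `ι_v` on superfields, for a tangent vector `v` at `x`. -/
abbrev iv {x : M} (v : TM x) (s : Super gr (Fib W x)) : Super gr (Fib W x) :=
  contr gr (evalT v) s

theorem iotaS_mem1 {k l : ℕ} {j : ℤ} (n : ℤ) (hn : 1 + j = n) (ξ : Vect M gr 1) {s : SF W gr}
    (hs : s ∈ Om W gr (k + 1) l j) : iotaS gr ξ.1 s ∈ Om W gr k l n :=
  iotaS_mem gr hn ξ.2 hs

/-- The contraction `ι_ξ` as an operator on fields. -/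
def ιξ (ξ : Vect M gr 1) {k l : ℕ} {j : ℤ} (n : ℤ) (s : Om W gr (k + 1) l j)
    (hn : 1 + j = n := by norm_num) : Om W gr k l n :=
  ⟨iotaS gr ξ.1 s.1, iotaS_mem1 n hn ξ s.2⟩

/-- The antifield `τ†` of `BF` theory as a function of the fields of `𝓕_PP`: the solution of
`ξ†_a = τ† e_a + e† ω†_a + ω χ†_a`, which is unique as `e` is an isomorphism. -/
def FieldsPP.τDag (y : FieldsPP W gr) : Om W gr 3 2 (-2) :=
  Classical.epsilon fun t => ∀ (x : M) (v : TM x), y.ξDag x v =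
    t.1 x * iv v (y.e.1 x) + y.eDag.1 x * iv v (y.omegaDag.1 x) + y.omega.1 x * iv v (y.χDag.1 x)

/-- The symplectomorphism `φ_PP : 𝓕_PP → 𝓕_BF`, in superfields
`𝔹 = e^{-ι_ξ}(e + ω† + χ†)` and `𝔸 = e^{-ι_ξ}(χ + ω + e† + τ†)`. The connection `A₀` is the
reference connection used to regard the one-form `ω` as a connection. -/
def φPP (A₀ : Conn gr m) (y : FieldsPP W gr) : FieldsBF gr m where
  τ := -ιξ y.ξ 1 y.e + (1 / 2 : ℝ) • ιξ y.ξ 1 (ιξ y.ξ 0 y.omegaDag)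
    - (1 / 6 : ℝ) • ιξ y.ξ 1 (ιξ y.ξ 0 (ιξ y.ξ (-1) y.χDag))
  B := y.e - ιξ y.ξ 0 y.omegaDag + (1 / 2 : ℝ) • ιξ y.ξ 0 (ιξ y.ξ (-1) y.χDag)
  ADag := y.omegaDag - ιξ y.ξ (-1) y.χDag
  cDag := y.χDag
  c := y.χ - ιξ y.ξ 1 y.omega + (1 / 2 : ℝ) • ιξ y.ξ 1 (ιξ y.ξ 0 y.eDag)
    - (1 / 6 : ℝ) • ιξ y.ξ 1 (ιξ y.ξ 0 (ιξ y.ξ (-1) y.τDag))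
  A := A₀.addForm
    (y.omega - ιξ y.ξ 0 y.eDag + (1 / 2 : ℝ) • ιξ y.ξ 0 (ιξ y.ξ (-1) y.τDag))
  BDag := y.eDag - ιξ y.ξ (-1) y.τDag
  τDag := y.τDag

/-- The antifield `τ†` of `BF` theory as a function of the fields of `𝓕_GR`: the solution of
`ξ†_a = τ† e_a + e† (ω† + ι_ξ χ†)_a`, which is unique as `e` is an isomorphism. -/
def FieldsGR.τDag (y : FieldsGR gr m) : Om W gr 3 2 (-2) :=
  Classical.epsilon fun t => ∀ (x : M) (v : TM x), y.ξDag x v =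
    t.1 x * iv v (y.e.1 x) + y.eDag.1 x * iv v ((y.omegaDag + ιξ y.ξ (-1) y.χDag).1 x)

/-- The symplectomorphism `φ_GR : 𝓕_GR → 𝓕_BF`, the composition of `φ_PP` with the
symplectomorphism `𝓕_GR → 𝓕_PP` that sends `ω†` to `ω† + ι_ξ χ†`, `χ` to `χ + ι_ξ ω`, and `ξ†_a`
to `ξ†_a + ω χ†_a`, and keeps `e, ω, ξ, e†, χ†`. -/
def φGR (y : FieldsGR gr m) : FieldsBF gr m where
  τ := -ιξ y.ξ 1 y.e + (1 / 2 : ℝ) • ιξ y.ξ 1 (ιξ y.ξ 0 y.omegaDag)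
    + (1 / 3 : ℝ) • ιξ y.ξ 1 (ιξ y.ξ 0 (ιξ y.ξ (-1) y.χDag))
  B := y.e - ιξ y.ξ 0 y.omegaDag - (1 / 2 : ℝ) • ιξ y.ξ 0 (ιξ y.ξ (-1) y.χDag)
  ADag := y.omegaDag
  cDag := y.χDag
  c := y.χ + (1 / 2 : ℝ) • ιξ y.ξ 1 (ιξ y.ξ 0 y.eDag)
    - (1 / 6 : ℝ) • ιξ y.ξ 1 (ιξ y.ξ 0 (ιξ y.ξ (-1) y.τDag))
  A := y.omega.addForm
    (-ιξ y.ξ 0 y.eDag + (1 / 2 : ℝ) • ιξ y.ξ 0 (ιξ y.ξ (-1) y.τDag))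
  BDag := y.eDag - ιξ y.ξ (-1) y.τDag
  τDag := y.τDag

/-- The homogeneous components, by form degree, of the superfield `𝔹 = τ + B + A† + c†`. -/
def FieldsBF.superB (z : FieldsBF gr m) : ℕ → SF W gr
  | 0 => z.τ.1
  | 1 => z.B.1
  | 2 => z.ADag.1
  | 3 => z.cDag.1
  | _ => 0

/-- The component of form degree `i` of `e^{t ι_ξ} 𝔹`. -/
def expIota (t : ℝ) (ξ : Vect M gr 1) (b : ℕ → SF W gr) (i : ℕ) : SF W gr :=
  ∑ n ∈ Finset.range 4, (t ^ n / n.factorial) • (iotaS gr ξ.1 ^ n) (b (i + n))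

/-- The integral `∫_M Tr s ∈ G` of a superfield: its part in `Ω³(M, Λ³W) ⊗ G` is traced with the
volume form of `W` and integrated coefficientwise, with respect to a basis of `G`. -/
def integralTr [T2Space M] [CompactSpace M] (m : Minkowski W) (s : SF W gr) : G :=
  let b := Module.Basis.ofVectorSpace ℝ G
  ∑ᶠ i, integral (fun x v => b.coord i (trTop gr (m.vol x) v (s x))) • b i

/-- `L(t) = ∫_M Tr (e^{t ι_ξ} 𝔹)³`. -/
def L [T2Space M] [CompactSpace M] (ξ : Vect M gr 1) (z : FieldsBF gr m) (t : ℝ) : G :=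
  integralTr m ((∑ i ∈ Finset.range 4, expIota t ξ z.superB i) ^ 3)

end Bundle

end Manifold

end BVGravity

/-!
The first two assertions are identities between polynomials in `ι_ξ`: `φ_PP` is built so that
`𝔹 = e^{-ι_ξ}(e + ω† + χ†)`, and passing to `φ_GR` replaces `ω†` by `ω† + ι_ξ χ†`, which does not
change the components of `e^{ι_ξ} 𝔹` of form degree zero and one.

For the third assertion everything happens in one fibre. As `ξ` has ghost number one and `G` is
graded commutative, `ι_ξ` is an even derivation of `Λ(T* ⊕ W) ⊗ G` (`iota_mul`): it is the product
of an odd parameter and an odd derivation. Its exponential is therefore multiplicative, so that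
`(e^{tι_ξ} 𝔹)³` is a polynomial in `t` solving `dP/dt = ι_ξ P` with constant term `𝔹³`
(`coeff_derivative_mul`). Its higher coefficients lie in the image of `ι_ξ`, and the trace vanishes
on this image (`trTop_iota`): it looks only at the part of form degree three, and `ι_ξ s` has no
such part since four contractions with vectors of a three-dimensional space compose to zero
(`contractLeft_four`). Hence the integrand of `L(t)` does not depend on `t`
(`trTop_exp_pow_three`), and no property of the integral is needed.
-/

namespace BVGravity

/-! ### Contraction as an even derivation -/

section Fibre

variable {V : Type*} [AddCommGroup V] [Module ℝ V]

theorem ι_mem_extGrading (m : V) : ExteriorAlgebra.ι ℝ m ∈ extGrading V 1 := by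
  change ExteriorAlgebra.ι ℝ m ∈ LinearMap.range (ExteriorAlgebra.ι ℝ (M := V)) ^ 1
  rw [pow_one]
  exact ⟨m, rfl⟩

theorem contractLeft_mem_extGrading (d : Module.Dual ℝ V) {i : ℤ} {a : ExteriorAlgebra ℝ V}
    (ha : a ∈ extGrading V i) :
    CliffordAlgebra.contractLeft (Q := (0 : QuadraticForm ℝ V)) d a ∈ extGrading V (i - 1) := by
  obtain n | n := i
  · change a ∈ ⋀[ℝ]^n V at ha
    induction ha using Submodule.pow_induction_on_left' with
    | algebraMap r =>
      rw [CliffordAlgebra.contractLeft_algebraMap]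
      exact Submodule.zero_mem _
    | add x y i hx hy ihx ihy =>
      rw [map_add]
      exact Submodule.add_mem _ ihx ihy
    | mem_mul m hm i x hx ih =>
      obtain ⟨m, rfl⟩ := hm
      have h2 : ExteriorAlgebra.ι ℝ m *
          CliffordAlgebra.contractLeft (Q := (0 : QuadraticForm ℝ V)) d x ∈
            extGrading V (1 + (Int.ofNat i - 1)) := SetLike.GradedMul.mul_mem (ι_mem_extGrading m) ih
      have e1 : (1 : ℤ) + (Int.ofNat i - 1) = Int.ofNat i := by ring
      have e2 : Int.ofNat (i + 1) - 1 = Int.ofNat i := by simp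
      rw [e1] at h2
      rw [e2]
      have h3 : CliffordAlgebra.contractLeft (Q := (0 : QuadraticForm ℝ V)) d
          (ExteriorAlgebra.ι ℝ m * x) = d m • x - ExteriorAlgebra.ι ℝ m *
            CliffordAlgebra.contractLeft (Q := (0 : QuadraticForm ℝ V)) d x :=
        CliffordAlgebra.contractLeft_ι_mul (Q := (0 : QuadraticForm ℝ V)) d m x
      rw [h3]
      exact Submodule.sub_mem _ (Submodule.smul_mem _ _ hx) h2
  · rw [(Submodule.mem_bot ℝ).1 ha, map_zero]
    exact Submodule.zero_mem _

variable {G : Type*} [Ring G] [Algebra ℝ G] (gr : ℤ → Submodule ℝ G) [GradedAlgebra gr]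

theorem tm_add (a b : ExteriorAlgebra ℝ V) (g : G) : tm gr (a + b) g = tm gr a g + tm gr b g := by
  rw [tm, TensorProduct.add_tmul, map_add]
  rfl

theorem tm_smul (r : ℝ) (a : ExteriorAlgebra ℝ V) (g : G) : tm gr (r • a) g = r • tm gr a g := by
  rw [tm, ← TensorProduct.smul_tmul', map_smul]
  rfl

theorem tm_zero (g : G) : tm gr (0 : ExteriorAlgebra ℝ V) g = 0 := by
  rw [tm, TensorProduct.zero_tmul, map_zero]

theorem tm_sub (a b : ExteriorAlgebra ℝ V) (g : G) : tm gr (a - b) g = tm gr a g - tm gr b g := by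
  rw [tm, TensorProduct.sub_tmul, map_sub]
  rfl

/-- Linear statements about `ΛV ⊗ G` may be checked on tensors of homogeneous elements. -/
theorem Super.induction_homogeneous {p : Super gr V → Prop} (s : Super gr V) (zero : p 0)
    (add : ∀ s t, p s → p t → p (s + t))
    (tm : ∀ (i j : ℤ) (a : ExteriorAlgebra ℝ V) (g : G), a ∈ extGrading V i → g ∈ gr j →
      p (tm gr a g)) : p s := by
  obtain ⟨s, rfl⟩ := (ofTensor gr).surjective s
  induction s using TensorProduct.induction_on with
  | zero => rwa [map_zero]
  | add a b ha hb => rw [map_add]; exact add _ _ ha hb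
  | tmul a g =>
    induction a using DirectSum.Decomposition.inductionOn (extGrading V) with
    | zero => rwa [TensorProduct.zero_tmul, map_zero]
    | add a b ha hb => rw [TensorProduct.add_tmul, map_add]; exact add _ _ ha hb
    | homogeneous a =>
      induction g using DirectSum.Decomposition.inductionOn gr with
      | zero => rwa [TensorProduct.tmul_zero, map_zero]
      | add a b ha hb => rw [TensorProduct.tmul_add, map_add]; exact add _ _ ha hb
      | homogeneous g => exact tm _ _ _ _ a.2 g.2

theorem inclG_mul_tm {i j : ℤ} {g : G} (hg : g ∈ gr i) {a : ExteriorAlgebra ℝ V}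
    (ha : a ∈ extGrading V j) (h : G) :
    inclG gr g * tm gr a h = (((-1 : ℤˣ) ^ (i * j) : ℤˣ) : ℤ) • tm gr a (g * h) := by
  rw [inclG_apply, tm_mul_tm gr 1 hg ha, one_mul]

/-- The unit of `G` is even, so no sign arises in moving it past `b`. -/
theorem tm_one_mul_tm (a b : ExteriorAlgebra ℝ V) (h : G) :
    tm gr a 1 * tm gr b h = tm gr (a * b) h := by
  induction b using DirectSum.Decomposition.inductionOn (extGrading V) with
  | zero => simp [tm_zero]
  | add b c hb hc =>
    rw [tm_add, mul_add, mul_add, tm_add, hb, hc]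
  | homogeneous b =>
    rw [tm_mul_tm gr a (SetLike.GradedOne.one_mem (A := gr)) b.2, zero_mul, one_mul]
    simp

theorem contr_inclG_mul (d : Module.Dual ℝ V) {i : ℤ} {g : G} (hg : g ∈ gr i) (s : Super gr V) :
    contr gr d (inclG gr g * s) =
      (((-1 : ℤˣ) ^ i : ℤˣ) : ℤ) • (inclG gr g * contr gr d s) := by
  induction s using Super.induction_homogeneous with
  | zero => simp
  | add s t hs ht => simp only [mul_add, map_add, hs, ht, smul_add]
  | tm j k a h ha hh =>
    rw [inclG_mul_tm gr hg ha, map_zsmul, contr_tm, contr_tm,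
      inclG_mul_tm gr hg (contractLeft_mem_extGrading d ha), smul_smul]
    congr 1
    rw [← Units.val_mul, ← zpow_add]
    congr 2
    have : i + i * (j - 1) = i * j := by ring
    rw [this]

theorem contr_ι_mul (d : Module.Dual ℝ V) (m : V) (s : Super gr V) :
    contr gr d (tm gr (ExteriorAlgebra.ι ℝ m) 1 * s) =
      d m • s - tm gr (ExteriorAlgebra.ι ℝ m) 1 * contr gr d s := by
  induction s using Super.induction_homogeneous with
  | zero => simp
  | add s t hs ht => simp only [mul_add, map_add, hs, ht, smul_add]; abel
  | tm j k a h ha hh =>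
    have h3 : CliffordAlgebra.contractLeft (Q := (0 : QuadraticForm ℝ V)) d
        (ExteriorAlgebra.ι ℝ m * a) = d m • a - ExteriorAlgebra.ι ℝ m *
          CliffordAlgebra.contractLeft (Q := (0 : QuadraticForm ℝ V)) d a :=
      CliffordAlgebra.contractLeft_ι_mul (Q := (0 : QuadraticForm ℝ V)) d m a
    rw [tm_one_mul_tm, contr_tm, contr_tm, tm_one_mul_tm, h3,
      tm_sub, tm_smul]

theorem contr_one (d : Module.Dual ℝ V) : contr gr d (1 : Super gr V) = 0 := by
  change contr gr d (tm gr 1 1) = 0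
  rw [contr_tm, CliffordAlgebra.contractLeft_one, tm_zero]

/-- A parameter of odd ghost number anticommutes with the generators of `ΛV`. -/
theorem inclG_mul_ι {g : G} (hg : g ∈ gr 1) (m : V) :
    inclG gr g * tm gr (ExteriorAlgebra.ι ℝ m) 1 =
      -(tm gr (ExteriorAlgebra.ι ℝ m) 1 * inclG gr g) := by
  rw [inclG_mul_tm gr hg (ι_mem_extGrading m), inclG_apply, tm_one_mul_tm]
  simp

/-- `ΛV ⊗ G` is generated by `V ⊗ 1` and `1 ⊗ G`. -/
theorem Super.mem_of_generators (S : Subalgebra ℝ (Super gr V))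
    (hι : ∀ m : V, tm gr (ExteriorAlgebra.ι ℝ m) 1 ∈ S)
    (hG : ∀ (i : ℤ), ∀ g ∈ gr i, inclG gr g ∈ S) (s : Super gr V) : s ∈ S := by
  have key : ∀ a : ExteriorAlgebra ℝ V, tm gr a 1 ∈ S := by
    intro a
    induction a using ExteriorAlgebra.induction with
    | algebraMap r =>
      rw [Algebra.algebraMap_eq_smul_one, tm_smul]
      exact S.smul_mem S.one_mem r
    | ι m => exact hι m
    | mul a b ha hb => rw [← tm_one_mul_tm]; exact S.mul_mem ha hb
    | add a b ha hb =>
      rw [tm_add]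
      exact S.add_mem ha hb
  induction s using Super.induction_homogeneous with
  | zero => exact S.zero_mem
  | add s t hs ht => exact S.add_mem hs ht
  | tm i j a g ha hg =>
    have : tm gr a g = tm gr a 1 * inclG gr g := by
      rw [inclG_apply, tm_one_mul_tm, mul_one]
    rw [this]
    exact S.mul_mem (key a) (hG j g hg)

/-- The Leibniz rule for `g ι_d` with `g` odd: both `g` and `ι_d` are odd, so their product is an
even derivation. The elements `s` satisfying the rule form a subalgebra, so that it suffices to
check it on generators. -/
theorem inclG_mul_contr_mul
    (hgr : ∀ i j : ℤ, ∀ a ∈ gr i, ∀ b ∈ gr j,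
      a * b = (((-1 : ℤˣ) ^ (i * j) : ℤˣ) : ℤ) • (b * a))
    (d : Module.Dual ℝ V) {g : G} (hg : g ∈ gr 1) (s t : Super gr V) :
    inclG gr g * contr gr d (s * t) =
      inclG gr g * contr gr d s * t + s * (inclG gr g * contr gr d t) := by
  let D : Super gr V →ₗ[ℝ] Super gr V := LinearMap.mulLeft ℝ (inclG gr g) ∘ₗ contr gr d
  have hD1 : D 1 = 0 := by
    change inclG gr g * contr gr d 1 = 0
    rw [contr_one, mul_zero]
  let S : Subalgebra ℝ (Super gr V) :=
    { carrier := {s | ∀ t, D (s * t) = D s * t + s * D t}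
      mul_mem' := by
        intro s s' hs hs' t
        rw [mul_assoc, hs, hs', hs s']
        noncomm_ring
      add_mem' := by
        intro s s' hs hs' t
        rw [add_mul, map_add, map_add, hs, hs']
        noncomm_ring
      algebraMap_mem' := by
        intro r t
        rw [Algebra.algebraMap_eq_smul_one, map_smul, hD1, smul_one_mul, map_smul, smul_zero,
          zero_mul, zero_add, smul_one_mul] }
  refine Super.mem_of_generators gr S (fun m t => ?_) (fun i h hh t => ?_) s t
  · have h1 := contr_ι_mul gr d m 1
    rw [mul_one, contr_one, mul_zero, sub_zero] at h1
    change inclG gr g * contr gr d _ = inclG gr g * contr gr d _ * t + _ * (inclG gr g * _)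
    rw [contr_ι_mul, h1, mul_sub, ← mul_assoc, inclG_mul_ι gr hg, mul_smul_comm, mul_smul_comm,
      mul_one, smul_mul_assoc]
    noncomm_ring
  · have h1 := contr_inclG_mul gr d hh 1
    rw [mul_one, contr_one, mul_zero, smul_zero] at h1
    change inclG gr g * contr gr d _ = inclG gr g * contr gr d _ * t + _ * (inclG gr g * _)
    rw [contr_inclG_mul gr d hh, h1, mul_zero, zero_mul, zero_add, mul_smul_comm, ← mul_assoc,
      ← mul_assoc, ← map_mul, ← map_mul, hgr 1 i g hg h hh, one_mul, map_zsmul, smul_mul_assoc,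
      smul_smul, ← Units.val_mul, ← mul_zpow]
    simp

variable {T U : Type*} [AddCommGroup T] [Module ℝ T] [AddCommGroup U] [Module ℝ U]

theorem iota_mul
    (hgr : ∀ i j : ℤ, ∀ a ∈ gr i, ∀ b ∈ gr j,
      a * b = (((-1 : ℤˣ) ^ (i * j) : ℤˣ) : ℤ) • (b * a))
    {ξ : T ⊗[ℝ] G} (hξ : ξ ∈ Submodule.span ℝ {ξ | ∃ v : T, ∃ g ∈ gr 1, ξ = v ⊗ₜ[ℝ] g})
    (s t : Super gr (Module.Dual ℝ T × U)) :
    iota gr ξ (s * t) = iota gr ξ s * t + s * iota gr ξ t := by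
  induction hξ using Submodule.span_induction with
  | mem ξ hξ =>
    obtain ⟨v, g, hg, rfl⟩ := hξ
    rw [iota_tmul, iota_tmul, iota_tmul]
    exact inclG_mul_contr_mul (V := Module.Dual ℝ T × U) gr hgr (evalT v) hg s t
  | zero =>
    rw [map_zero, LinearMap.zero_apply, LinearMap.zero_apply, LinearMap.zero_apply, zero_mul,
      mul_zero, add_zero]
  | add a b _ _ ha hb =>
    rw [map_add, LinearMap.add_apply, LinearMap.add_apply, LinearMap.add_apply, ha, hb, add_mul,
      mul_add]
    exact add_add_add_comm _ _ _ _
  | smul c a _ ha =>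
    rw [map_smul, LinearMap.smul_apply, LinearMap.smul_apply, LinearMap.smul_apply, ha, smul_add,
      smul_mul_assoc, mul_smul_comm]

/-! ### The trace vanishes on contractions -/

/-- Contractions square to zero, so they factor through `ΛT`, and `Λ⁴T = 0`. -/
theorem contractLeft_four [Module.Finite ℝ T] (hT : Module.finrank ℝ T < 4) (w v₀ v₁ v₂ : T)
    (a : ExteriorAlgebra ℝ (Module.Dual ℝ T × U)) :
    CliffordAlgebra.contractLeft (Q := (0 : QuadraticForm ℝ (Module.Dual ℝ T × U))) (evalT v₂)
      (CliffordAlgebra.contractLeft (Q := (0 : QuadraticForm ℝ (Module.Dual ℝ T × U))) (evalT v₁)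
        (CliffordAlgebra.contractLeft (Q := (0 : QuadraticForm ℝ (Module.Dual ℝ T × U)))
          (evalT v₀)
          (CliffordAlgebra.contractLeft (Q := (0 : QuadraticForm ℝ (Module.Dual ℝ T × U)))
            (evalT w) a))) = 0 := by
  let c : T →ₗ[ℝ] Module.End ℝ (ExteriorAlgebra ℝ (Module.Dual ℝ T × U)) :=
    CliffordAlgebra.contractLeft (Q := (0 : QuadraticForm ℝ (Module.Dual ℝ T × U))) ∘ₗ evalT
  have hc : ∀ v, c v * c v = 0 := fun v => LinearMap.ext fun b =>
    CliffordAlgebra.contractLeft_contractLeft (Q := (0 : QuadraticForm ℝ (Module.Dual ℝ T × U)))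
      (d := evalT v) b
  have hdep : ¬LinearIndependent ℝ ![v₂, v₁, v₀, w] := fun h => by
    have := h.fintype_card_le_finrank
    rw [Fintype.card_fin] at this
    omega
  have h0 := congrArg (ExteriorAlgebra.lift ℝ ⟨c, hc⟩)
    ((ExteriorAlgebra.ιMulti ℝ 4 (M := T)).map_linearDependent _ hdep)
  simp only [ExteriorAlgebra.ιMulti_apply, List.ofFn_succ, List.ofFn_zero, List.prod_cons,
    List.prod_nil, map_mul, ExteriorAlgebra.lift_ι_apply, map_zero, mul_one] at h0
  exact LinearMap.congr_fun h0 a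

theorem trTop_tm (vol : U [⋀^Fin 3]→ₗ[ℝ] ℝ) (v : Fin 3 → T)
    (a : ExteriorAlgebra ℝ (Module.Dual ℝ T × U)) (g : G)
    (ha : CliffordAlgebra.contractLeft (Q := (0 : QuadraticForm ℝ (Module.Dual ℝ T × U)))
      (evalT (v 2))
      (CliffordAlgebra.contractLeft (Q := (0 : QuadraticForm ℝ (Module.Dual ℝ T × U)))
        (evalT (v 1))
        (CliffordAlgebra.contractLeft (Q := (0 : QuadraticForm ℝ (Module.Dual ℝ T × U)))
          (evalT (v 0)) a)) = 0) :
    trTop gr vol v (tm gr a g) = 0 := by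
  simp [trTop, tm, ha]

/-- A form of the shape `ι_ξ s` has no component of form degree three, so its trace vanishes. -/
theorem trTop_iota [Module.Finite ℝ T] (hT : Module.finrank ℝ T < 4)
    (vol : U [⋀^Fin 3]→ₗ[ℝ] ℝ) (v : Fin 3 → T)
    {ξ : T ⊗[ℝ] G} (hξ : ξ ∈ Submodule.span ℝ {ξ | ∃ v : T, ∃ g ∈ gr 1, ξ = v ⊗ₜ[ℝ] g})
    (s : Super gr (Module.Dual ℝ T × U)) : trTop gr vol v (iota gr ξ s) = 0 := by
  induction hξ using Submodule.span_induction with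
  | mem ξ hξ =>
    obtain ⟨w, g, hg, rfl⟩ := hξ
    rw [iota_tmul]
    induction s using Super.induction_homogeneous with
    | zero => simp
    | add s t hs ht => rw [map_add, mul_add, map_add, hs, ht, add_zero]
    | tm i j a h ha hh =>
      rw [contr_tm, inclG_mul_tm gr hg (contractLeft_mem_extGrading _ ha), map_zsmul,
        trTop_tm gr vol v _ _ (contractLeft_four hT w _ _ _ a), smul_zero]
  | zero => simp
  | add a b _ _ ha hb => simp only [map_add, LinearMap.add_apply, ha, hb, add_zero]
  | smul c a _ ha => simp only [map_smul, LinearMap.smul_apply, ha, smul_zero]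

end Fibre

/-! ### The flow of a nilpotent derivation -/

section Flow

variable {R : Type*} [Ring R] [Algebra ℝ R] (D : R →ₗ[ℝ] R)

theorem coeff_derivative_eq_smul (P : Polynomial R) (n : ℕ) :
    P.derivative.coeff n = ((n : ℝ) + 1) • P.coeff (n + 1) := by
  rw [Polynomial.coeff_derivative, Algebra.smul_def, map_add, map_one, map_natCast]
  exact ((Nat.cast_commute n _).symm.add_right (Commute.one_right _)).eq

/-- Polynomial solutions of `dP/dt = D P`, for `D` a derivation, are closed under products. -/
theorem coeff_derivative_mul (hD : ∀ a b, D (a * b) = D a * b + a * D b) {P Q : Polynomial R}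
    (hP : ∀ n, D (P.coeff n) = P.derivative.coeff n)
    (hQ : ∀ n, D (Q.coeff n) = Q.derivative.coeff n) (n : ℕ) :
    D ((P * Q).coeff n) = (P * Q).derivative.coeff n := by
  rw [Polynomial.derivative_mul, Polynomial.coeff_add, Polynomial.coeff_mul, Polynomial.coeff_mul,
    Polynomial.coeff_mul, map_sum, ← Finset.sum_add_distrib]
  exact Finset.sum_congr rfl fun i _ => by rw [hD, hP, hQ]

/-- A linear form that kills the image of `D` is constant along polynomial solutions of
`dP/dt = D P`. -/
theorem map_eval_eq_of_flow {N : Type*} [AddCommGroup N] [Module ℝ N] (f : R →ₗ[ℝ] N)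
    (hf : ∀ a, f (D a) = 0) {P : Polynomial R} (hP : ∀ n, D (P.coeff n) = P.derivative.coeff n)
    (t : ℝ) : f (P.eval (algebraMap ℝ R t)) = f (P.coeff 0) := by
  have hc : ∀ n, f (P.coeff (n + 1)) = 0 := fun n => by
    have h := congrArg f (hP n)
    rw [hf, coeff_derivative_eq_smul, map_smul] at h
    exact (smul_eq_zero.1 h.symm).resolve_left (by positivity)
  rw [Polynomial.eval_eq_sum_range, Finset.sum_range_succ', map_add, map_sum,
    Finset.sum_eq_zero, zero_add, pow_zero, mul_one]
  intro n _
  rw [← map_pow, ← Algebra.commutes, ← Algebra.smul_def, map_smul, hc, smul_zero]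

/-- If `D` is a derivation with `D⁴ b = 0` and `f` kills the image of `D`, then `f ((e^{tD} b)³)`
does not depend on `t`. -/
theorem map_exp_pow_three (hD : ∀ a b, D (a * b) = D a * b + a * D b)
    {N : Type*} [AddCommGroup N] [Module ℝ N] (f : R →ₗ[ℝ] N) (hf : ∀ a, f (D a) = 0)
    {b : R} (hb : (D ^ 4) b = 0) (t : ℝ) :
    f ((∑ n ∈ Finset.range 4, (t ^ n / n.factorial) • (D ^ n) b) ^ 3) = f (b ^ 3) := by
  let P : Polynomial R :=
    ∑ n ∈ Finset.range 4, Polynomial.monomial n ((1 / n.factorial : ℝ) • (D ^ n) b)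
  have hPc : ∀ n, P.coeff n = if n < 4 then (1 / n.factorial : ℝ) • (D ^ n) b else 0 := by
    intro n
    simp [P, Polynomial.coeff_monomial]
  have hP : ∀ n, D (P.coeff n) = P.derivative.coeff n := by
    intro n
    rw [coeff_derivative_eq_smul, hPc, hPc]
    by_cases h4 : 4 ≤ n
    · rw [if_neg (by omega), if_neg (by omega), map_zero, smul_zero]
    rw [if_pos (by omega), map_smul, ← Module.End.mul_apply, ← pow_succ']
    by_cases h3 : n = 3
    · subst h3
      rw [hb, if_neg (by norm_num), smul_zero, smul_zero]
    · rw [if_pos (by omega), smul_smul, Nat.factorial_succ]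
      congr 1
      have : (n.factorial : ℝ) ≠ 0 := by positivity
      push_cast
      field_simp
  have hP3 : ∀ n, D ((P ^ 3).coeff n) = (P ^ 3).derivative.coeff n := by
    rw [pow_three]
    exact coeff_derivative_mul D hD hP (coeff_derivative_mul D hD hP hP)
  let ev := Polynomial.eval₂RingHom' (RingHom.id R) (algebraMap ℝ R t)
    fun a => (Algebra.commutes t a).symm
  have hev : ev P = ∑ n ∈ Finset.range 4, (t ^ n / n.factorial) • (D ^ n) b := by
    simp only [P, map_sum]
    refine Finset.sum_congr rfl fun n _ => ?_
    change Polynomial.eval₂ _ _ _ = _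
    rw [Polynomial.eval₂_monomial, RingHom.id_apply, ← map_pow, ← Algebra.commutes,
      ← Algebra.smul_def, smul_smul, mul_one_div]
  have h0 : (P ^ 3).coeff 0 = b ^ 3 := by
    have : P.coeff 0 = b := by simp [hPc]
    rw [pow_three, Polynomial.mul_coeff_zero, Polynomial.mul_coeff_zero, this, pow_three]
  have hmain := map_eval_eq_of_flow D f hf hP3 t
  rw [h0] at hmain
  rw [← hmain, ← hev, ← map_pow]
  rfl

end Flow

/-! ### Superfields -/

section Fields

variable {M : Type*} [TopologicalSpace M] [ChartedSpace E3 M] [IsManifold 𝓘(ℝ, E3) ∞ M]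
variable {W : M → Type*} [TopologicalSpace (Bundle.TotalSpace E3 W)]
  [∀ x, AddCommGroup (W x)] [∀ x, Module ℝ (W x)] [∀ x, TopologicalSpace (W x)]
  [FiberBundle E3 W] [VectorBundle ℝ E3 W] [ContMDiffVectorBundle ∞ E3 W 𝓘(ℝ, E3)]
variable {G : Type*} [Ring G] [Algebra ℝ G] {gr : ℤ → Submodule ℝ G} [GradedAlgebra gr]

theorem Vect.apply_mem_span {i : ℤ} {ξ : ∀ x : M, TM x ⊗[ℝ] G} (hξ : ξ ∈ Vect M gr i) (x : M) :
    ξ x ∈ Submodule.span ℝ {ξ | ∃ v : TM x, ∃ g ∈ gr i, ξ = v ⊗ₜ[ℝ] g} := by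
  induction hξ using Submodule.span_induction with
  | mem ξ hξ =>
    obtain ⟨X, g, hg, h⟩ := hξ
    exact Submodule.subset_span ⟨X x, g, hg, h x⟩
  | zero => exact Submodule.zero_mem _
  | add a b _ _ ha hb => exact Submodule.add_mem _ ha hb
  | smul c a _ ha => exact Submodule.smul_mem _ c ha

theorem Form.ctr_eq_zero {l : ℕ} {a : ∀ x : M, ExteriorAlgebra ℝ (Fib W x)}
    (ha : a ∈ Form W 0 l) (x : M) (v : TM x) : ctr W (evalT v) (a x) = 0 := by
  classical
  induction ha using Submodule.span_induction with
  | mem a ha =>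
    obtain ⟨f, α, w, ha⟩ := ha
    have h := ctr_prodForm_zero (Function.update (fun _ => 0) x v) α w x
    rw [Function.update_self] at h
    rw [ha x]
    simp only [map_smul]
    exact (congrArg _ h).trans (smul_zero _)
  | zero => simp
  | add a b _ _ ha hb => simp only [Pi.add_apply, map_add, ha, hb, add_zero]
  | smul c a _ ha => simp only [Pi.smul_apply, map_smul, ha, smul_zero]

theorem iotaS_eq_zero {l : ℕ} {i j : ℤ} {ξ : ∀ x : M, TM x ⊗[ℝ] G} (hξ : ξ ∈ Vect M gr i)
    {s : SF W gr} (hs : s ∈ Om W gr 0 l j) : iotaS gr ξ s = 0 := by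
  induction hs using Submodule.span_induction with
  | mem s hs =>
    obtain ⟨a, ha, g, hg, hs⟩ := hs
    funext x
    change iota gr (ξ x) (s x) = 0
    have hx := Vect.apply_mem_span hξ x
    rw [hs x]
    generalize ξ x = η at hx
    induction hx using Submodule.span_induction with
    | mem η hη =>
      obtain ⟨v, h, hh, rfl⟩ := hη
      rw [iota_tmul, contr_tm]
      have := Form.ctr_eq_zero ha x v
      rw [ctr] at this
      rw [this, tm_zero, mul_zero]
    | zero => simp
    | add a b _ _ ha hb => simp only [map_add, LinearMap.add_apply, ha, hb, add_zero]
    | smul c a _ ha => simp only [map_smul, LinearMap.smul_apply, ha, smul_zero]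
  | zero => simp
  | add a b _ _ ha hb => rw [map_add, ha, hb, add_zero]
  | smul c a _ ha => rw [map_smul, ha, smul_zero]

theorem iotaS_pow_eq_zero {k n l : ℕ} {i j : ℤ} (hkn : k < n) {ξ : ∀ x : M, TM x ⊗[ℝ] G}
    (hξ : ξ ∈ Vect M gr i) {s : SF W gr} (hs : s ∈ Om W gr k l j) :
    (iotaS gr ξ ^ n) s = 0 := by
  induction k generalizing n s j with
  | zero =>
    obtain ⟨n, rfl⟩ := Nat.exists_eq_succ_of_ne_zero (Nat.ne_of_gt hkn)
    rw [pow_succ, Module.End.mul_apply, iotaS_eq_zero hξ hs, map_zero]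
  | succ k ih =>
    obtain ⟨n, rfl⟩ := Nat.exists_eq_succ_of_ne_zero (Nat.ne_of_gt (Nat.zero_lt_of_lt hkn))
    rw [pow_succ, Module.End.mul_apply]
    exact ih (Nat.lt_of_succ_lt_succ hkn) (iotaS_mem gr rfl hξ hs)

variable {m : Minkowski W}

theorem FieldsBF.iotaS_pow_superB (z : FieldsBF gr m) (ξ : Vect M gr 1) {k n : ℕ} (hkn : k < n) :
    (iotaS gr ξ.1 ^ n) (z.superB k) = 0 := by
  match k with
  | 0 => exact iotaS_pow_eq_zero hkn ξ.2 z.τ.2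
  | 1 => exact iotaS_pow_eq_zero hkn ξ.2 z.B.2
  | 2 => exact iotaS_pow_eq_zero hkn ξ.2 z.ADag.2
  | 3 => exact iotaS_pow_eq_zero hkn ξ.2 z.cDag.2
  | _ + 4 => exact map_zero _

/-- The sum of the components of `e^{t ι_ξ} 𝔹` is the truncated exponential applied to the sum of
the components of `𝔹`: the terms that the two sides do not share lower the form degree below zero,
or involve components of form degree above three. -/
theorem sum_expIota (z : FieldsBF gr m) (ξ : Vect M gr 1) (t : ℝ) :
    ∑ i ∈ Finset.range 4, expIota t ξ z.superB i =
      ∑ n ∈ Finset.range 4, (t ^ n / n.factorial) •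
        (iotaS gr ξ.1 ^ n) (∑ k ∈ Finset.range 4, z.superB k) := by
  have h4 : ∀ k, z.superB (k + 4) = 0 := fun _ => rfl
  simp only [expIota]
  rw [Finset.sum_comm]
  refine Finset.sum_congr rfl fun n hn => ?_
  rw [← Finset.smul_sum, map_sum]
  congr 1
  have h : ∀ k n, k < n → (iotaS gr ξ.1 ^ n) (z.superB k) = 0 := fun _ _ hkn =>
    z.iotaS_pow_superB ξ hkn
  have h01 : iotaS gr ξ.1 (z.superB 0) = 0 := h 0 1 one_pos
  rw [Finset.mem_range] at hn
  interval_cases n <;>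
    simp [Finset.sum_range_succ, h4 0, h4 1, h4 2, h01, h 0 2, h 1 2, h 0 3, h 1 3, h 2 3]

theorem trTop_exp_pow_three
    (hgr : ∀ i j : ℤ, ∀ a ∈ gr i, ∀ b ∈ gr j,
      a * b = (((-1 : ℤˣ) ^ (i * j) : ℤˣ) : ℤ) • (b * a))
    (z : FieldsBF gr m) (ξ : Vect M gr 1) (t : ℝ) (x : M) (v : Fin 3 → TM x) :
    trTop gr (m.vol x) v (((∑ i ∈ Finset.range 4, expIota t ξ z.superB i) ^ 3) x) =
      trTop gr (m.vol x) v (((∑ k ∈ Finset.range 4, z.superB k) x) ^ 3) := by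
  have hξ := Vect.apply_mem_span ξ.2 x
  have hpow : ∀ (n : ℕ) (s : SF W gr),
      ((iotaS gr ξ.1 ^ n) s) x = (iota gr (ξ.1 x) ^ n) (s x) := by
    intro n
    induction n with
    | zero => exact fun _ => rfl
    | succ n ih =>
      intro s
      rw [pow_succ, pow_succ, Module.End.mul_apply, Module.End.mul_apply, ih]
      rfl
  have hfin : Module.Finite ℝ (TM x) := inferInstanceAs (Module.Finite ℝ E3)
  have hrank : Module.finrank ℝ (TM x) < 4 := by
    change Module.finrank ℝ E3 < 4
    rw [finrank_euclideanSpace_fin]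
    norm_num
  have hnil : (iota gr (ξ.1 x) ^ 4) ((∑ k ∈ Finset.range 4, z.superB k) x) = 0 := by
    rw [← hpow, map_sum, Finset.sum_eq_zero]
    · rfl
    · exact fun k hk => z.iotaS_pow_superB ξ (Finset.mem_range.1 hk)
  rw [sum_expIota, Pi.pow_apply, Finset.sum_apply]
  simp only [Pi.smul_apply, hpow]
  exact map_exp_pow_three (iota gr (ξ.1 x)) (iota_mul gr hgr hξ) (trTop gr (m.vol x) v)
    (trTop_iota gr hrank (m.vol x) v hξ) hnil t

theorem L_eq [T2Space M] [CompactSpace M]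
    (hgr : ∀ i j : ℤ, ∀ a ∈ gr i, ∀ b ∈ gr j,
      a * b = (((-1 : ℤˣ) ^ (i * j) : ℤˣ) : ℤ) • (b * a))
    (ξ : Vect M gr 1) (z : FieldsBF gr m) (s t : ℝ) : L ξ z s = L ξ z t := by
  simp only [L, integralTr, trTop_exp_pow_three hgr]

theorem φPP_expIota_zero (A₀ : Conn gr m) (y : FieldsPP W gr) :
    expIota 1 y.ξ (φPP A₀ y).superB 0 = 0 := by
  simp only [expIota, Finset.sum_range_succ, Finset.sum_range_zero, FieldsBF.superB, φPP, ιξ,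
    Submodule.coe_add, Submodule.coe_sub, Submodule.coe_neg, Submodule.coe_smul, map_add, map_sub,
    map_neg, map_smul, pow_zero, pow_succ, Module.End.mul_apply, Module.End.one_apply,
    Nat.factorial, one_pow]
  push_cast
  module

theorem φPP_expIota_one (A₀ : Conn gr m) (y : FieldsPP W gr) :
    expIota 1 y.ξ (φPP A₀ y).superB 1 = y.e := by
  simp only [expIota, Finset.sum_range_succ, Finset.sum_range_zero, FieldsBF.superB, φPP, ιξ,
    Submodule.coe_add, Submodule.coe_sub, Submodule.coe_neg, Submodule.coe_smul, map_add, map_sub,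
    map_smul, pow_zero, pow_succ, Module.End.mul_apply, Module.End.one_apply,
    Nat.factorial, one_pow, map_zero]
  push_cast
  module

theorem φGR_expIota_zero (y : FieldsGR gr m) :
    expIota 1 y.ξ (φGR y).superB 0 = 0 := by
  simp only [expIota, Finset.sum_range_succ, Finset.sum_range_zero, FieldsBF.superB, φGR, ιξ,
    Submodule.coe_add, Submodule.coe_sub, Submodule.coe_neg, Submodule.coe_smul, map_add, map_sub,
    map_neg, map_smul, pow_zero, pow_succ, Module.End.mul_apply, Module.End.one_apply,
    Nat.factorial, one_pow]
  push_cast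
  module

theorem φGR_expIota_one (y : FieldsGR gr m) :
    expIota 1 y.ξ (φGR y).superB 1 = y.e := by
  simp only [expIota, Finset.sum_range_succ, Finset.sum_range_zero, FieldsBF.superB, φGR, ιξ,
    Submodule.coe_add, Submodule.coe_sub, Submodule.coe_neg, Submodule.coe_smul, map_sub,
    map_smul, pow_zero, pow_succ, Module.End.mul_apply, Module.End.one_apply,
    Nat.factorial, one_pow, map_zero]
  push_cast
  module

end Fields

end BVGravity

theorem mainTheorem3
    {M : Type*} [TopologicalSpace M] [T2Space M] [CompactSpace M] [ChartedSpace BVGravity.E3 M]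
    [IsManifold 𝓘(ℝ, BVGravity.E3) ∞ M] (hM : BVGravity.IsOrientedAtlas M)
    {W : M → Type*} [TopologicalSpace (Bundle.TotalSpace BVGravity.E3 W)]
    [∀ x, AddCommGroup (W x)] [∀ x, Module ℝ (W x)] [∀ x, TopologicalSpace (W x)]
    [FiberBundle BVGravity.E3 W] [VectorBundle ℝ BVGravity.E3 W]
    [ContMDiffVectorBundle ∞ BVGravity.E3 W 𝓘(ℝ, BVGravity.E3)]
    (m : BVGravity.Minkowski W)
    {G : Type*} [Ring G] [Algebra ℝ G] (gr : ℤ → Submodule ℝ G) [GradedAlgebra gr]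
    (hgr : ∀ i j : ℤ, ∀ a ∈ gr i, ∀ b ∈ gr j,
      a * b = (((-1 : ℤˣ) ^ (i * j) : ℤˣ) : ℤ) • (b * a)) :
    (∀ (A₀ : BVGravity.Conn gr m) (y : BVGravity.FieldsPP W gr),
      BVGravity.expIota 1 y.ξ (BVGravity.φPP A₀ y).superB 0 = 0 ∧
      BVGravity.expIota 1 y.ξ (BVGravity.φPP A₀ y).superB 1 = y.e) ∧
    (∀ y : BVGravity.FieldsGR gr m,
      BVGravity.expIota 1 y.ξ (BVGravity.φGR y).superB 0 = 0 ∧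
      BVGravity.expIota 1 y.ξ (BVGravity.φGR y).superB 1 = y.e) ∧
    (∀ (ξ : BVGravity.Vect M gr 1) (z : BVGravity.FieldsBF gr m) (s t : ℝ),
      BVGravity.L ξ z s = BVGravity.L ξ z t) := by
  exact ⟨fun A₀ y => ⟨BVGravity.φPP_expIota_zero A₀ y, BVGravity.φPP_expIota_one A₀ y⟩,
    fun y => ⟨BVGravity.φGR_expIota_zero y, BVGravity.φGR_expIota_one y⟩,
    fun ξ z s t => BVGravity.L_eq hgr ξ z s t⟩
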